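/- **Theorem (CDF of the harvested power, MISO).** Let $L\ge 1$, let $a_1,\dots,a_L$ be positive integers, and let $b_i,l_i,p_i>0$ ($1\le i\le L$) and $P_s,A,B>0$ be real numbers. Let $h_1,\dots,h_L$ be complex random fading coefficients such that $|h_1|,\dots,|h_L|$ are independent and $|h_i|$ has the Nakagami distribution with shape $a_i$ and spread $a_i/b_i$, i.e. density $$\frac{2\,b_i^{a_i}}{\Gamma(a_i)}\,x^{2a_i-1}e^{-b_i x^2},\qquad x\ge 0.$$ Let the harvested power be $$Q^M=\frac{P_s\left(1+e^{AB}\right)}{e^{AB}\left(1+e^{-A\left(\sum_{i=1}^L l_ip_i|h_i|^2-B\right)}\right)}-\frac{P_s}{e^{AB}},$$ and put $\beta_i=\frac{b_i}{l_ip_i}$, $sa_L=\sum_{i=1}^L a_i$, $\gamma(s,x)=\int_0^x t^{s-1}e^{-t}\,dt$ and, for $0\le q<P_s$, $$\Lambda(q)=\ln\left(\frac{P_s\left(1+e^{AB}\right)}{e^{AB}\left(q+\frac{P_s}{e^{AB}}\right)}-1\right)-AB .$$ For $1\le i\le L$ and $1\le k\le a_i$ let $$\Xi_L^0(i,k)=(-1)^{sa_L-a_i}\,\frac{\prod_{w=1}^L\beta_w^{a_w}}{\beta_i^{k}}\sum_{a_i=j_0\ge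 j_1\ge\cdots\ge j_{L-2}\ge j_{L-1}=k}\ \prod_{s=0}^{L-2}\frac{\left(j_s+a_{\sigma(s)}-j_{s+1}-1\right)!}{\left(a_{\sigma(s)}-1\right)!\,\left(j_s-j_{s+1}\right)!}\left(\beta_i-\beta_{\sigma(s)}\right)^{j_{s+1}-j_s-a_{\sigma(s)}},$$ where $\sigma(0)<\dots<\sigma(L-2)$ are the elements of $\{1,\dots,L\}\setminus\{i\}$, and the sum runs over integers $j_1,\dots,j_{L-2}$, the end points $j_0=a_i$ and $j_{L-1}=k$ being fixed. (For $L=1$ the product is empty, and the sum is $1$ if $k=a_1$ and $0$ otherwise.) Then the received power $\sum_{i=1}^L l_ip_i|h_i|^2$ is a sum of independent random variables $l_ip_i|h_i|^2$, the $i$-th of which is gamma distributed with shape $a_i$ and rate $\beta_i$. The CDF $F_{Q^M}(q)=P(Q^M\le q)$ is $0$ for $q<0$ and $1$ for $q\ge P_s$, and for $0\le q<P_s$ it is as follows. 1. If $\beta_1=\dots=\beta_L$, then, for every $i$, $$F_{Q^M}(q)=\frac{1}{\Gamma(sa_L)}\,\gamma\left(sa_L,\,-\frac{b_i}{A\,l_ip_i}\Lambda(q)\right).$$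 2. If $\beta_i\ne\beta_j$ for all $i\neq j$, then $$F_{Q^M}(q)=\sum_{i=1}^{L}\sum_{k=1}^{a_i}\frac{1}{\Gamma(k)}\,\gamma\left(k,\,-\frac{b_i}{A\,l_ip_i}\Lambda(q)\right)\Xi_L^0(i,k).$$ -/

import Mathlib

open MeasureTheory ProbabilityTheory

namespace MISO

noncomputable section

/-- Density of the Nakagami distribution with shape `m` and spread `w` (the mean square). -/
def nakagamiPDFReal (m w x : ℝ) : ℝ :=
  if 0 ≤ x then
    2 * m ^ m / (Real.Gamma m * w ^ m) * x ^ (2 * m - 1) * Real.exp (-(m / w) * x ^ 2)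
  else 0

/-- The Nakagami distribution with shape `m` and spread `w`, as a measure on the real line. -/
def nakagamiMeasure (m w : ℝ) : Measure ℝ :=
  volume.withDensity fun x => ENNReal.ofReal (nakagamiPDFReal m w x)

/-- The lower incomplete gamma function `γ(s, x) = ∫₀ˣ t ^ (s - 1) e ^ (-t) dt`. -/
def lowerGamma (s x : ℝ) : ℝ :=
  ∫ t in (0 : ℝ)..x, t ^ (s - 1) * Real.exp (-t)

/-- The received power `∑ i, l i * p i * |h i| ^ 2` from `L` antennas with path losses `l`,
transmitted powers `p` and fading coefficients `h`. -/
def receivedPower {L : ℕ} (l p : Fin L → ℝ) (h : Fin L → ℂ) : ℝ :=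
  ∑ i, l i * p i * ‖h i‖ ^ 2

/-- The power harvested by the nonlinear (logistic) circuit from the input power `x`, with
saturation level `Ps` and circuit constants `A`, `B`. -/
def harvestedPower (Ps A B x : ℝ) : ℝ :=
  Ps * (1 + Real.exp (A * B)) / (Real.exp (A * B) * (1 + Real.exp (-A * (x - B))))
    - Ps / Real.exp (A * B)

/-- `ln (Ps (1 + e^{AB}) / (e^{AB} (q + Ps / e^{AB})) - 1) - A B`. -/
def logTerm (Ps A B q : ℝ) : ℝ :=
  Real.log (Ps * (1 + Real.exp (A * B)) /
    (Real.exp (A * B) * (q + Ps / Real.exp (A * B))) - 1) - A * B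

/-- The index set of the nested sum in the weights for `L = n + 1` summands: all chains
`a = j₀ ≥ j₁ ≥ ⋯ ≥ j_{L-2} ≥ j_{L-1} = k`. The inner entries `j₁, …, j_{L-2}` are the summation
variables, the end points are fixed. -/
def chains (n a k : ℕ) : Finset (Fin (n + 1) → ℕ) :=
  open Classical in
  (Fintype.piFinset fun _ : Fin (n + 1) => Finset.Icc k a).filter
    fun j => Antitone j ∧ j 0 = a ∧ j (Fin.last n) = k

/-- The weight `Ξ⁰_L(i, k, {a_q}, {β_q})` for `L = n + 1`. With `j₀ = a i` and `j_{L-1} = k`, the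
first, the last and the intermediate factors of the closed formula all have the same shape. The
index `i.succAbove s` runs through all indices other than `i` in increasing order. -/
def Xi {n : ℕ} (i : Fin (n + 1)) (k : ℕ) (a : Fin (n + 1) → ℕ) (β : Fin (n + 1) → ℝ) : ℝ :=
  ∑ j ∈ chains n (a i) k,
    (-1 : ℝ) ^ ((∑ w, a w) - a i) * ((∏ w, β w ^ a w) / β i ^ k) *
      ∏ s : Fin n,
        ((Nat.factorial (j s.castSucc + a (i.succAbove s) - j s.succ - 1) : ℝ) /
            ((Nat.factorial (a (i.succAbove s) - 1) : ℝ) *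
              (Nat.factorial (j s.castSucc - j s.succ) : ℝ))) *
          (β i - β (i.succAbove s)) ^
            ((j s.succ : ℤ) - (j s.castSucc : ℤ) - (a (i.succAbove s) : ℤ))

end

end MISO

/-! The circuit response is an increasing logistic function of the received power `S`, so for `0 ≤ q
< Ps` the event `Q ≤ q` is `S ≤ -Λ(q)/A` (`harvestedPower_le_iff`), and only the law of `S` is
needed. A scaled squared Nakagami variable is gamma distributed, so the characteristic function of
`S` is the product of the factors `(β_i / (β_i - it)) ^ a_i`.

With equal rates this is the characteristic function of a single gamma law. With distinct rates,
partial fractions turn it into a real combination of the terms `(β_i / (β_i - it)) ^ k`, so `S` is a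
signed mixture of gamma laws (`measureReal_eq_sum_of_charFun_eq_sum`).

The weights are `Xi` because the coefficients at the pole `-β_i` are Taylor coefficients of the
product of the `(x + β_w - β_i) ^ (-a_w)` over `w ≠ i`. Expanding this product of series gives a sum
over exponents with fixed total; these exponents are the successive drops of a chain
(`sum_chains_prod`). -/

namespace MISO

/-! ### Chains as Cauchy products, and partial fractions over a field. -/

section PartialFractions

open Finset Polynomial

lemma mem_chains {n a k : ℕ} {j : Fin (n + 1) → ℕ} :
    j ∈ chains n a k ↔ Antitone j ∧ j 0 = a ∧ j (Fin.last n) = k := by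
  simp only [chains, mem_filter, Fintype.mem_piFinset, mem_Icc, and_iff_right_iff_imp]
  rintro ⟨hj, rfl, rfl⟩ s
  exact ⟨hj (Fin.le_last s), hj (Fin.zero_le s)⟩

lemma cons_mem_chains {n a k : ℕ} {j : Fin (n + 1) → ℕ} :
    (Fin.cons a j : Fin (n + 2) → ℕ) ∈ chains (n + 1) a k ↔ j 0 ≤ a ∧ j ∈ chains n (j 0) k := by
  simp only [mem_chains, Fin.antitone_iff_succ_le, Fin.forall_fin_succ (n := n), Fin.cons_zero,
    Fin.cons_succ, Fin.castSucc_zero, ← Fin.succ_last, true_and]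
  simp only [← Fin.succ_castSucc, Fin.cons_succ]
  tauto

/-- The sum over chains of a product of functions of the successive drops is a coefficient of a
product of power series. -/
lemma sum_chains_prod {K : Type*} [CommSemiring K] {n : ℕ} (g : Fin n → ℕ → K) {a k : ℕ}
    (hk : k ≤ a) :
    ∑ j ∈ chains n a k, ∏ s, g s (j s.castSucc - j s.succ) =
      PowerSeries.coeff (a - k) (∏ s, PowerSeries.mk (g s)) := by
  induction n generalizing a with
  | zero =>
    -- Without factors a chain is a single entry, so it exists only for `a = k`; this matches the
    -- coefficients of the series `1`.
    rcases hk.eq_or_lt with rfl | hlt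
    · have : chains 0 k k = {fun _ => k} := by
        ext j
        simp only [mem_chains, mem_singleton, Fin.last_zero, and_self]
        refine ⟨fun h => funext fun s => by
          rw [show s = 0 from Fin.eq_zero s, h.2], ?_⟩
        rintro rfl
        exact ⟨antitone_const, rfl⟩
      simp [this]
    · have : chains 0 a k = ∅ := by
        refine eq_empty_of_forall_notMem fun j hj => ?_
        obtain ⟨-, h0, h1⟩ := mem_chains.1 hj
        have : j 0 = k := h1
        omega
      rw [this, sum_empty, univ_eq_empty, prod_empty, PowerSeries.coeff_one, if_neg (by omega)]
  | succ n ih =>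
    rw [Fin.prod_univ_succ, PowerSeries.coeff_mul]
    -- The Cauchy product splits off the first drop `x.1 = a - j 1`; the remaining chain starts at
    -- `j 1 = k + x.2`.
    have hrw : ∀ x ∈ antidiagonal (a - k),
        PowerSeries.coeff x.1 (PowerSeries.mk (g 0)) *
          PowerSeries.coeff x.2 (∏ s : Fin n, PowerSeries.mk (g s.succ)) =
        ∑ j ∈ chains n (k + x.2) k, g 0 x.1 * ∏ s : Fin n, g s.succ (j s.castSucc - j s.succ) := by
      intro x _
      rw [PowerSeries.coeff_mk, ← mul_sum, ih (fun s => g s.succ) (Nat.le_add_right k x.2),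
        Nat.add_sub_cancel_left]
    rw [sum_congr rfl hrw, sum_sigma']
    refine sum_bij' (fun j _ => ⟨(a - j 1, j 1 - k), Fin.tail j⟩) (fun x _ => Fin.cons a x.2)
      ?_ ?_ ?_ ?_ ?_
    · intro j hj
      obtain ⟨j0, j, rfl⟩ : ∃ j0 j', j = Fin.cons j0 j' := ⟨_, _, (Fin.cons_self_tail j).symm⟩
      obtain rfl : j0 = a := (mem_chains.1 hj).2.1
      obtain ⟨h0, hj⟩ := cons_mem_chains.1 hj
      have hkj : k ≤ j 0 := by
        obtain ⟨h1, -, h3⟩ := mem_chains.1 hj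
        exact h3 ▸ h1 (Fin.zero_le _)
      have : (Fin.cons j0 j : Fin (n + 2) → ℕ) 1 = j 0 := rfl
      simp only [mem_sigma, HasAntidiagonal.mem_antidiagonal, Fin.tail_cons, this]
      refine ⟨by omega, ?_⟩
      rwa [Nat.add_sub_cancel' hkj]
    · rintro ⟨⟨p, q⟩, j⟩ hx
      simp only [mem_sigma, HasAntidiagonal.mem_antidiagonal] at hx
      obtain ⟨hpq, hj⟩ := hx
      have h0 := (mem_chains.1 hj).2.1
      exact cons_mem_chains.2 ⟨by dsimp only; omega, by dsimp only; rwa [h0]⟩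
    · intro j hj
      rw [← (mem_chains.1 hj).2.1]
      exact Fin.cons_self_tail j
    · rintro ⟨⟨p, q⟩, j⟩ hx
      simp only [mem_sigma, HasAntidiagonal.mem_antidiagonal] at hx
      obtain ⟨hpq, hj⟩ := hx
      have h0 := (mem_chains.1 hj).2.1
      have h1 : (Fin.cons a j : Fin (n + 2) → ℕ) 1 = j 0 := rfl
      simp only [Fin.tail_cons, h1, h0, Sigma.mk.injEq, Prod.mk.injEq, heq_eq_eq, and_true]
      omega
    · intro j hj
      have h0 := (mem_chains.1 hj).2.1
      rw [Fin.prod_univ_succ]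
      congr 1
      rw [Fin.castSucc_zero, h0]
      rfl

/-- Explicit partial fraction decomposition, with the denominators cleared: the coefficients at
the root `-β i` are the Taylor coefficients there of the inverse of the product of the other
factors. -/
lemma sum_coeff_mul_prod_eq_one {K ι : Type*} [Field K] [Fintype ι] [DecidableEq ι] [Nonempty ι]
    (β : ι → K) (hβ : Function.Injective β) (a : ι → ℕ) (ha : ∀ i, 0 < a i)
    (C : ι → PowerSeries K)
    (hC : ∀ i, C i * ∏ w ∈ univ.erase i, (PowerSeries.X + PowerSeries.C (β w - β i)) ^ a w = 1) :
    ∑ i, ∑ k ∈ Icc 1 (a i), Polynomial.C (PowerSeries.coeff (a i - k) (C i)) *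
      (X + Polynomial.C (β i)) ^ (a i - k) *
        ∏ w ∈ univ.erase i, (X + Polynomial.C (β w)) ^ a w = 1 := by
  set T : ι → K[X] := fun i => ∑ k ∈ Icc 1 (a i), Polynomial.C (PowerSeries.coeff (a i - k) (C i)) *
      (X + Polynomial.C (β i)) ^ (a i - k) *
        ∏ w ∈ univ.erase i, (X + Polynomial.C (β w)) ^ a w with hT
  change ∑ i, T i = 1
  -- Moving the root `-β i` to `0` reduces this to a congruence modulo `X ^ a i`, where truncating
  -- the inverse series `C i` changes nothing.
  have hself : ∀ i, (X + Polynomial.C (β i)) ^ a i ∣ T i - 1 := by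
    intro i
    set P : K[X] := PowerSeries.trunc (a i) (C i) *
      ∏ w ∈ univ.erase i, (X + Polynomial.C (β w - β i)) ^ a w - 1 with hP
    have hdvd : X ^ a i ∣ P := by
      rw [X_pow_dvd_iff]
      intro d hd
      rw [hP, ← Polynomial.coeff_coe]
      have h1 := congrArg (fun f => Polynomial.coeff f d)
        (PowerSeries.trunc_trunc_mul (n := a i) (C i)
          (∏ w ∈ univ.erase i, (PowerSeries.X + PowerSeries.C (β w - β i)) ^ a w))
      simp only [hC, PowerSeries.coeff_trunc, if_pos hd] at h1
      rw [Polynomial.coe_sub, map_sub, Polynomial.coe_mul, sub_eq_zero, Polynomial.coe_one, ← h1]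
      congr 2
      rw [← Polynomial.coeToPowerSeries.ringHom_apply, map_prod]
      refine prod_congr rfl fun w _ => ?_
      rw [map_pow, map_add, Polynomial.coeToPowerSeries.ringHom_apply,
        Polynomial.coeToPowerSeries.ringHom_apply, Polynomial.coe_X, Polynomial.coe_C]
    have := map_dvd (Polynomial.compRingHom (X + Polynomial.C (β i))) hdvd
    convert this using 1
    · simp
    · rw [hP, hT, map_sub, map_mul, map_prod, map_one]
      congr 1
      beta_reduce
      rw [← sum_mul]
      congr 1
      · rw [PowerSeries.trunc_apply, map_sum]
        refine sum_bij' (fun k _ => a i - k) (fun k _ => a i - k) ?_ ?_ ?_ ?_ ?_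
        · intro k hk; simp at hk ⊢; omega
        · intro k hk; simp at hk ⊢; omega
        · intro k hk; simp at hk ⊢; omega
        · intro k hk; simp at hk ⊢; omega
        · intro k hk
          simp
      · refine prod_congr rfl fun w _ => ?_
        simp [add_assoc]
  have hother : ∀ i i', i ≠ i' → (X + Polynomial.C (β i)) ^ a i ∣ T i' := by
    intro i i' hne
    refine dvd_sum fun k _ => Dvd.dvd.mul_left ?_ _
    exact dvd_prod_of_mem (fun w => (X + Polynomial.C (β w)) ^ a w) (by simp [hne])
  have hdvd : ∏ i, (X + Polynomial.C (β i)) ^ a i ∣ (∑ i, T i) - 1 := by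
    refine Finset.prod_dvd_of_coprime ?_ ?_
    · intro i _ i' _ hne
      refine IsCoprime.pow ?_
      have := isCoprime_X_sub_C_of_isUnit_sub (a := -β i) (b := -β i') (R := K) ?_
      · simpa [sub_neg_eq_add] using this
      · rw [isUnit_iff_ne_zero]
        intro h0
        exact hne (hβ (by linear_combination -h0))
    · intro i _
      rw [← add_sum_erase univ T (mem_univ i), add_sub_right_comm]
      refine dvd_add (hself i) (dvd_sum fun i' hi' => hother i i' ?_)
      exact (ne_of_mem_erase hi').symm
  have hmonic : (∏ i, (X + Polynomial.C (β i)) ^ a i).Monic :=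
    monic_prod_of_monic _ _ fun i _ => (monic_X_add_C _).pow _
  have hdeg : (∏ i, (X + Polynomial.C (β i)) ^ a i).natDegree = ∑ i, a i := by
    rw [natDegree_prod_of_monic _ _ fun i _ => (monic_X_add_C _).pow _]
    simp
  have hpos : 0 < ∑ i, a i := sum_pos (fun i _ => ha i) univ_nonempty
  -- The coprime factors together divide `∑ T i - 1`, whose degree is too small for a nonzero
  -- multiple. The bound uses `k ≥ 1`.
  have hlt : ((∑ i, T i) - 1).natDegree < ∑ i, a i := by
    suffices h : ((∑ i, T i) - 1).natDegree ≤ (∑ i, a i) - 1 by omega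
    refine (natDegree_sub_le _ _).trans (max_le ?_ (by simp))
    refine natDegree_sum_le_of_forall_le _ _ fun i _ => ?_
    refine natDegree_sum_le_of_forall_le _ _ fun k hk => ?_
    rw [mem_Icc] at hk
    refine natDegree_mul_le.trans ?_
    have h1 : (Polynomial.C (PowerSeries.coeff (a i - k) (C i)) *
      (X + Polynomial.C (β i)) ^ (a i - k)).natDegree ≤ a i - k := by
      refine (natDegree_C_mul_le _ _).trans ?_
      simp
    have h2 : (∏ w ∈ univ.erase i, (X + Polynomial.C (β w)) ^ a w).natDegree =
        ∑ w ∈ univ.erase i, a w := by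
      rw [natDegree_prod_of_monic _ _ fun i _ => (monic_X_add_C _).pow _]
      simp
    have h3 := add_sum_erase univ a (mem_univ i)
    omega
  by_contra h0
  exact hmonic.not_dvd_of_natDegree_lt (sub_ne_zero.2 h0) (by rwa [hdeg]) hdvd

/-- Taylor expansion of `(X - δ) ^ (-a)`. -/
def invPowSeries {K : Type*} [Field K] (δ : K) (a : ℕ) : PowerSeries K :=
  PowerSeries.mk fun m => (-1) ^ a * (((m + a - 1).factorial : K) /
    (((a - 1).factorial : K) * (m.factorial : K)) * (δ ^ (m + a))⁻¹)

/-- Since `X - δ = -δ (1 - X / δ)`, this is the binomial series of `(1 - X) ^ (-a)` rescaled by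
`δ⁻¹`. -/
lemma invPowSeries_mul {K : Type*} [Field K] [CharZero K] {δ : K} (hδ : δ ≠ 0) {a : ℕ}
    (ha : 0 < a) : invPowSeries δ a * (PowerSeries.X + PowerSeries.C (-δ)) ^ a = 1 := by
  have h1 := congrArg (PowerSeries.rescale δ⁻¹)
    (PowerSeries.invOneSubPow K a).val_inv
  rw [PowerSeries.invOneSubPow_inv_eq_one_sub_pow, map_mul, map_pow, map_one,
    PowerSeries.invOneSubPow_val_eq_mk_sub_one_add_choose_of_pos _ _ ha] at h1
  have h2 : (PowerSeries.X + PowerSeries.C (-δ)) =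
      PowerSeries.C (-δ) * PowerSeries.rescale δ⁻¹ (1 - PowerSeries.X : PowerSeries K) := by
    rw [map_sub, map_one, PowerSeries.rescale_X, mul_sub, ← mul_assoc, ← map_mul, mul_one,
      neg_mul, mul_inv_cancel₀ hδ]
    simp [add_comm]
  have h3 : invPowSeries δ a = PowerSeries.C ((-δ) ^ a)⁻¹ * PowerSeries.rescale δ⁻¹
      (PowerSeries.mk fun n => ((a - 1 + n).choose (a - 1) : K)) := by
    ext m
    rw [PowerSeries.coeff_C_mul, PowerSeries.coeff_rescale, invPowSeries, PowerSeries.coeff_mk,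
      PowerSeries.coeff_mk, Nat.cast_choose K (Nat.le_add_right _ _), Nat.add_sub_cancel_left,
      neg_pow δ, show m + a - 1 = a - 1 + m by omega, pow_add]
    have : ((-1 : K) ^ a)⁻¹ = (-1) ^ a := by
      rw [← inv_pow, inv_neg, inv_one]
    rw [mul_inv ((-1) ^ a) (δ ^ a), this, mul_inv, inv_pow]
    ring
  rw [h2, h3, mul_pow, ← map_pow]
  calc _ = PowerSeries.C (((-δ) ^ a)⁻¹ * (-δ) ^ a) *
        (PowerSeries.rescale δ⁻¹ (PowerSeries.mk fun n => ((a - 1 + n).choose (a - 1) : K)) *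
          PowerSeries.rescale δ⁻¹ (1 - PowerSeries.X) ^ a) := by rw [map_mul]; ac_rfl
    _ = 1 := by rw [inv_mul_cancel₀ (pow_ne_zero _ (neg_ne_zero.2 hδ)), map_one, one_mul, h1]

end PartialFractions

end MISO

namespace MISO

/-! ### The weights `Xi` as partial fraction coefficients. -/

section Weights

open Finset

lemma prod_erase_eq_prod_succAbove {M : Type*} [CommMonoid M] {n : ℕ} (i : Fin (n + 1))
    (f : Fin (n + 1) → M) : ∏ w ∈ univ.erase i, f w = ∏ s, f (i.succAbove s) := by
  have : univ.erase i = univ.image i.succAbove := by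
    rw [Fin.image_succAbove_univ]
    ext
    simp
  rw [this, prod_image fun _ _ _ _ h => Fin.succAbove_right_injective h]

/-- Each factor of `Xi` depends on the chain only through one drop, and the global sign is shared
out as `(-1) ^ a w` over `w ≠ i`, so `sum_chains_prod` applies. -/
lemma Xi_eq_coeff {n : ℕ} (i : Fin (n + 1)) {k : ℕ} (a : Fin (n + 1) → ℕ)
    (β : Fin (n + 1) → ℝ) (hk : k ≤ a i) :
    Xi i k a β = (∏ w, β w ^ a w) / β i ^ k * PowerSeries.coeff (a i - k)
      (∏ w ∈ univ.erase i, invPowSeries (β i - β w) (a w)) := by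
  rw [prod_erase_eq_prod_succAbove]
  simp only [invPowSeries]
  rw [← sum_chains_prod _ hk, Xi, mul_sum]
  refine sum_congr rfl fun j hj => ?_
  obtain ⟨hanti, -, -⟩ := mem_chains.1 hj
  have hsum : (∑ w, a w) - a i = ∑ s, a (i.succAbove s) := by
    rw [Fin.sum_univ_succAbove _ i, Nat.add_sub_cancel_left]
  rw [hsum, ← prod_pow_eq_pow_sum, mul_comm (∏ s : Fin n, (-1 : ℝ) ^ a (i.succAbove s)), mul_assoc,
    ← prod_mul_distrib]
  congr 1
  refine prod_congr rfl fun s _ => ?_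
  have hle : j s.succ ≤ j s.castSucc := hanti (Fin.castSucc_lt_succ).le
  rw [← zpow_natCast (β i - β (i.succAbove s)), ← zpow_neg,
    show j s.castSucc + a (i.succAbove s) - j s.succ - 1 =
      j s.castSucc - j s.succ + a (i.succAbove s) - 1 by omega]
  congr 3
  push_cast [Nat.cast_sub hle]
  ring

/-- Partial fraction decomposition of a product of Laplace transforms of gamma distributions with
pairwise distinct rates. -/
lemma prod_div_pow_eq_sum_Xi {n : ℕ} (a : Fin (n + 1) → ℕ) (ha : ∀ i, 0 < a i)
    (β : Fin (n + 1) → ℝ) (hβ : Function.Injective β) (hβ0 : ∀ i, β i ≠ 0) (z : ℂ)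
    (hz : ∀ i, (β i : ℂ) + z ≠ 0) :
    ∏ w, ((β w : ℂ) / (β w + z)) ^ a w =
      ∑ i, ∑ k ∈ Icc 1 (a i), (Xi i k a β : ℂ) * ((β i : ℂ) / (β i + z)) ^ k := by
  have hpf := sum_coeff_mul_prod_eq_one β hβ a ha
    (fun i => ∏ w ∈ univ.erase i, invPowSeries (β i - β w) (a w)) (by
      intro i
      rw [← prod_mul_distrib]
      refine prod_eq_one fun w hw => ?_
      rw [← neg_sub (β i) (β w)]
      exact invPowSeries_mul (sub_ne_zero.2 fun h => ne_of_mem_erase hw (hβ h).symm) (ha w))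
  have hev := congrArg (Polynomial.eval₂ Complex.ofRealHom z) hpf
  simp only [Polynomial.eval₂_finsetSum, Polynomial.eval₂_mul, Polynomial.eval₂_pow,
    Polynomial.eval₂_finsetProd, Polynomial.eval₂_add, Polynomial.eval₂_X, Polynomial.eval₂_C,
    Polynomial.eval₂_one, Complex.ofRealHom_eq_coe] at hev
  rw [← mul_one (∏ w, _), ← hev, mul_sum]
  refine sum_congr rfl fun i _ => ?_
  rw [mul_sum]
  refine sum_congr rfl fun k hk => ?_
  rw [mem_Icc] at hk
  rw [Xi_eq_coeff i a β hk.2]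
  simp only [div_pow, prod_div_distrib]
  rw [← mul_prod_erase univ (fun w => ((β w : ℂ) + z) ^ a w) (mem_univ i)]
  push_cast
  have h1 : ∏ w ∈ univ.erase i, ((β w : ℂ) + z) ^ a w ≠ 0 :=
    prod_ne_zero_iff.2 fun w _ => pow_ne_zero _ (hz w)
  have h2 : (β i : ℂ) ^ k ≠ 0 := pow_ne_zero _ (Complex.ofReal_ne_zero.2 (hβ0 i))
  have h3 : ((β i : ℂ) + z) ^ a i = (β i + z) ^ (a i - k) * (β i + z) ^ k := by
    rw [← pow_add, Nat.sub_add_cancel hk.2]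
  have h4 := pow_ne_zero k (hz i)
  have h5 := pow_ne_zero (a i - k) (hz i)
  rw [h3, add_comm z]
  simp only [add_comm z]
  field_simp

end Weights

end MISO

namespace MISO

/-! ### Gamma laws: characteristic function, CDF, link with Nakagami, signed mixtures. -/

section GammaDistribution

open Set Filter Topology

lemma integrableOn_pow_mul_cexp_neg_mul {z : ℂ} (hz : 0 < z.re) (m : ℕ) :
    IntegrableOn (fun t : ℝ => (t : ℂ) ^ m * Complex.exp (-(z * t))) (Ioi 0) := by
  have h := integrableOn_rpow_mul_exp_neg_mul_rpow (p := 1) (s := m)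
    (by linarith [Nat.cast_nonneg (α := ℝ) m]) one_pos hz
  refine Integrable.mono' h (by fun_prop) ?_
  refine (ae_restrict_iff' measurableSet_Ioi).2 (ae_of_all _ fun t (ht : 0 < t) => ?_)
  rw [norm_mul, norm_pow, Complex.norm_real, Complex.norm_exp, Real.norm_of_nonneg ht.le,
    Real.rpow_natCast, Real.rpow_one]
  simp

/-- Integration by parts: `t ^ (m + 1) * exp (-z t)` vanishes at both ends. Complex `z` is needed
for the characteristic function, where `z = r - it`. -/
lemma integral_pow_mul_cexp_neg_mul {z : ℂ} (hz : 0 < z.re) (m : ℕ) :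
    ∫ t : ℝ in Ioi 0, (t : ℂ) ^ m * Complex.exp (-(z * t)) = m.factorial / z ^ (m + 1) := by
  have hz0 : z ≠ 0 := by rintro rfl; simp at hz
  induction m with
  | zero =>
    have h := integral_exp_mul_complex_Ioi (a := -z) (by simpa using hz) 0
    simpa using h
  | succ m ih =>
    have hlim : Tendsto (fun t : ℝ => (t : ℂ) ^ (m + 1) * Complex.exp (-(z * t))) atTop (𝓝 0) := by
      rw [tendsto_zero_iff_norm_tendsto_zero]
      have h := tendsto_rpow_mul_exp_neg_mul_atTop_nhds_zero ((m + 1 : ℕ) : ℝ) z.re hz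
      refine h.congr' ?_
      filter_upwards [eventually_gt_atTop 0] with t ht
      rw [norm_mul, norm_pow, Complex.norm_real, Complex.norm_exp, Real.norm_of_nonneg ht.le,
        Real.rpow_natCast]
      simp
    have hderiv : ∀ t ∈ Ici (0 : ℝ), HasDerivAt
        (fun t : ℝ => (t : ℂ) ^ (m + 1) * Complex.exp (-(z * t)))
        ((m + 1 : ℂ) * ((t : ℂ) ^ m * Complex.exp (-(z * t))) -
          z * ((t : ℂ) ^ (m + 1) * Complex.exp (-(z * t)))) t := by
      intro t _
      have h1 : HasDerivAt (fun w : ℂ => w ^ (m + 1) * Complex.exp (-(z * w)))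
          ((m + 1 : ℂ) * ((t : ℂ) ^ m * Complex.exp (-(z * t))) -
          z * ((t : ℂ) ^ (m + 1) * Complex.exp (-(z * t)))) (t : ℂ) := by
        have h2 := (hasDerivAt_pow (m + 1) (t : ℂ)).mul
          (((hasDerivAt_id (t : ℂ)).const_mul z).neg.cexp)
        refine h2.congr_deriv ?_
        simp
        ring
      exact h1.comp_ofReal
    have i1 := (integrableOn_pow_mul_cexp_neg_mul hz m).const_mul (m + 1 : ℂ)
    have i2 := (integrableOn_pow_mul_cexp_neg_mul hz (m + 1)).const_mul z
    have key := integral_Ioi_of_hasDerivAt_of_tendsto' hderiv (i1.sub i2) hlim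
    rw [integral_sub i1 i2, integral_const_mul, integral_const_mul, ih] at key
    simp only [Complex.ofReal_zero, zero_pow (Nat.succ_ne_zero m), zero_mul, sub_zero] at key
    have h3 := sub_eq_zero.1 key
    rw [eq_div_iff (pow_ne_zero _ hz0), pow_succ z (m + 1), Nat.factorial_succ]
    rw [mul_div_assoc', eq_comm, eq_div_iff (pow_ne_zero _ hz0)] at h3
    push_cast
    linear_combination h3

/-- Characteristic function of a gamma distribution with integer shape. -/
lemma charFun_gammaMeasure {k : ℕ} (hk : 0 < k) {r : ℝ} (hr : 0 < r) (t : ℝ) :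
    charFun (gammaMeasure k r) t = ((r : ℂ) / (r + -(t * Complex.I))) ^ k := by
  have hk' : (0 : ℝ) < k := Nat.cast_pos.2 hk
  rw [charFun_apply_real, gammaMeasure,
    show gammaPDF k r = fun x => ENNReal.ofReal (gammaPDFReal k r x) from rfl,
    integral_withDensity_eq_integral_toReal_smul (measurable_gammaPDFReal k r).ennreal_ofReal
      (ae_of_all _ fun x => ENNReal.ofReal_lt_top)]
  have h1 : ∀ x : ℝ, (ENNReal.ofReal (gammaPDFReal k r x)).toReal • Complex.exp (t * x * Complex.I) =
      (gammaPDFReal k r x : ℂ) * Complex.exp (t * x * Complex.I) := by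
    intro x
    rw [ENNReal.toReal_ofReal (gammaPDFReal_nonneg hk' hr x), Complex.real_smul]
  simp_rw [h1]
  rw [← setIntegral_eq_integral_of_forall_compl_eq_zero (s := Ici 0), integral_Ici_eq_integral_Ioi]
  · have hz : 0 < ((r : ℂ) + -(t * Complex.I)).re := by simpa using hr
    obtain ⟨m, rfl⟩ : ∃ m, k = m + 1 := ⟨k - 1, by omega⟩
    have h2 : ∀ x ∈ Ioi (0 : ℝ), (gammaPDFReal ((m + 1 : ℕ) : ℝ) r x : ℂ) *
        Complex.exp (t * x * Complex.I) = ((r : ℂ) ^ (m + 1) / m.factorial) *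
          ((x : ℂ) ^ m * Complex.exp (-(((r : ℂ) + -(t * Complex.I)) * x))) := by
      intro x hx
      rw [gammaPDFReal, if_pos (le_of_lt hx), Real.rpow_natCast]
      have : ((m + 1 : ℕ) : ℝ) - 1 = m := by push_cast; ring
      rw [this, Real.rpow_natCast, Nat.cast_succ, Real.Gamma_nat_eq_factorial]
      push_cast
      rw [mul_assoc, mul_assoc, mul_assoc, ← Complex.exp_add]
      congr 4
      ring
    rw [setIntegral_congr_fun measurableSet_Ioi h2, integral_const_mul,
      integral_pow_mul_cexp_neg_mul hz, div_pow]
    have : (m.factorial : ℂ) ≠ 0 := Nat.cast_ne_zero.2 m.factorial_ne_zero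
    field_simp
  · intro x hx
    rw [gammaPDFReal, if_neg (by simpa using hx)]
    simp

/-- Distribution function of a gamma distribution. -/
lemma measureReal_gammaMeasure_Iic {k r x : ℝ} (hk : 0 < k) (hr : 0 < r) (hx : 0 ≤ x) :
    (gammaMeasure k r).real (Iic x) = 1 / Real.Gamma k * lowerGamma k (r * x) := by
  have := isProbabilityMeasure_gammaMeasure hk hr
  rw [← cdf_eq_real, cdf_gammaMeasure_eq_integral hk hr,
    setIntegral_eq_of_subset_of_forall_sdiff_eq_zero (s := Icc 0 x) measurableSet_Iic
      (fun y hy => hy.2), integral_Icc_eq_integral_Ioc, ← intervalIntegral.integral_of_le hx]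
  · have h1 : ∀ y ∈ uIcc 0 x, gammaPDFReal k r y =
        r / Real.Gamma k * ((r * y) ^ (k - 1) * Real.exp (-(r * y))) := by
      intro y hy
      rw [uIcc_of_le hx] at hy
      -- Only the power of `r` is turned into a quotient, since `y` may be `0`.
      rw [gammaPDFReal, if_pos hy.1, Real.mul_rpow hr.le hy.1, Real.rpow_sub_one hr.ne']
      field_simp
    rw [intervalIntegral.integral_congr h1, intervalIntegral.integral_const_mul,
      intervalIntegral.integral_comp_mul_left (fun t => t ^ (k - 1) * Real.exp (-t)) hr.ne',
      mul_zero, lowerGamma, smul_eq_mul]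
    field_simp
  · intro y hy
    rw [gammaPDFReal, if_neg]
    intro h0
    exact hy.2 ⟨h0, hy.1⟩

/-- The scaled square of a Nakagami variable is gamma distributed. -/
lemma hasLaw_mul_sq_nakagamiMeasure {m b c : ℝ} (hm : 0 < m) (hb : 0 < b) (hc : 0 < c) :
    HasLaw (fun x => c * x ^ 2) (gammaMeasure m (b / c)) (nakagamiMeasure m (m / b)) := by
  refine ⟨by fun_prop, ?_⟩
  ext s hs
  have hmeas : Measurable fun x : ℝ => c * x ^ 2 := by fun_prop
  rw [Measure.map_apply hmeas hs, nakagamiMeasure, gammaMeasure,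
    withDensity_apply _ (hmeas hs), withDensity_apply _ hs,
    ← lintegral_indicator (hmeas hs), ← lintegral_indicator hs]
  -- Both densities vanish on the negative axis, and `x ↦ c * x ^ 2` is injective only after
  -- restriction to a half-line.
  have hnonneg : ∀ f : ℝ → ENNReal, (∀ x < 0, f x = 0) → ∫⁻ x, f x = ∫⁻ x in Ioi 0, f x := by
    intro f hf
    rw [setLIntegral_congr Ioi_ae_eq_Ici, ← lintegral_indicator measurableSet_Ici]
    refine lintegral_congr fun x => ?_
    by_cases hx : x ∈ Ici (0 : ℝ)
    · rw [indicator_of_mem hx]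
    · rw [indicator_of_notMem hx, hf x (by simpa using hx)]
  have himage : (fun x : ℝ => c * x ^ 2) '' Ioi 0 = Ioi 0 := by
    ext y
    simp only [mem_image, mem_Ioi]
    constructor
    · rintro ⟨x, hx, rfl⟩
      positivity
    · intro hy
      refine ⟨√(y / c), by positivity, ?_⟩
      rw [Real.sq_sqrt (by positivity)]
      field_simp
  have hinj : InjOn (fun x : ℝ => c * x ^ 2) (Ioi 0) := by
    intro x hx y hy hxy
    exact (pow_left_inj₀ (le_of_lt hx) (le_of_lt hy) two_ne_zero).1 (mul_left_cancel₀ hc.ne' hxy)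
  have hderiv : ∀ x ∈ Ioi (0 : ℝ), HasDerivWithinAt (fun x : ℝ => c * x ^ 2) (c * (2 * x))
      (Ioi 0) x := by
    intro x _
    simpa using ((hasDerivAt_pow 2 x).const_mul c).hasDerivWithinAt
  rw [hnonneg _ (fun x hx => ?_), hnonneg (s.indicator _) (fun x hx => ?_)]
  · conv_rhs => rw [← himage]
    rw [lintegral_image_eq_lintegral_abs_deriv_mul measurableSet_Ioi hderiv hinj]
    refine setLIntegral_congr_fun measurableSet_Ioi fun x (hx : 0 < x) => ?_
    by_cases hxs : c * x ^ 2 ∈ s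
    · rw [indicator_of_mem (show x ∈ (fun x : ℝ => c * x ^ 2) ⁻¹' s from hxs),
        indicator_of_mem hxs, gammaPDF, ← ENNReal.ofReal_mul (abs_nonneg _)]
      congr 1
      rw [abs_of_pos (by positivity), nakagamiPDFReal, gammaPDFReal, if_pos hx.le,
        if_pos (by positivity), Real.mul_rpow hc.le (by positivity),
        Real.div_rpow hb.le hc.le, Real.div_rpow hm.le hb.le, ← Real.rpow_natCast x 2,
        ← Real.rpow_mul hx.le, Real.rpow_sub_one hc.ne', Real.rpow_sub_one hx.ne',
        show ((2 : ℕ) : ℝ) * (m - 1) = 2 * m - 2 by push_cast; ring,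
        show 2 * m - 2 = (2 * m - 1) - 1 by ring, Real.rpow_sub_one hx.ne' (2 * m - 1),
        Real.rpow_sub_one hx.ne' (2 * m),
        show -(m / (m / b)) * x ^ ((2 : ℕ) : ℝ) = -(b / c * (c * x ^ ((2 : ℕ) : ℝ))) by field_simp]
      field_simp
    · rw [indicator_of_notMem (show x ∉ (fun x : ℝ => c * x ^ 2) ⁻¹' s from hxs),
        indicator_of_notMem hxs, mul_zero]
  · exact indicator_apply_eq_zero.2 fun _ => gammaPDF_of_neg hx
  · refine indicator_apply_eq_zero.2 fun _ => ?_
    rw [nakagamiPDFReal, if_neg hx.not_ge, ENNReal.ofReal_zero]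

/-- A finite measure whose characteristic function is a real linear combination of characteristic
functions of finite measures is the same linear combination of these measures. -/
lemma measureReal_eq_sum_of_charFun_eq_sum {ι : Type*} (J : Finset ι) (μ : Measure ℝ)
    [IsFiniteMeasure μ] (ν : ι → Measure ℝ) [∀ i, IsFiniteMeasure (ν i)] (c : ι → ℝ)
    (h : ∀ t, charFun μ t = ∑ i ∈ J, (c i : ℂ) * charFun (ν i) t) (s : Set ℝ) :
    μ.real s = ∑ i ∈ J, c i * (ν i).real s := by
  have hsplit : ∀ i, ((c i).toNNReal : ℝ) - ((-c i).toNNReal : ℝ) = c i := fun i => by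
    rw [Real.coe_toNNReal', Real.coe_toNNReal']
    exact max_zero_sub_eq_self (c i)
  have hint : ∀ (ρ : Measure ℝ) [IsFiniteMeasure ρ] (t : ℝ),
      Integrable (fun x : ℝ => Complex.exp (t * x * Complex.I)) ρ := by
    intro ρ _ t
    refine Integrable.of_bound (by fun_prop) 1 (ae_of_all _ fun x => ?_)
    rw [← Complex.ofReal_mul, Complex.norm_exp_ofReal_mul_I]
  have hsum : ∀ (d : ι → NNReal) (t : ℝ), charFun (∑ i ∈ J, d i • ν i) t =
      ∑ i ∈ J, ((d i : ℝ) : ℂ) * charFun (ν i) t := by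
    intro d t
    simp only [charFun_apply_real]
    rw [integral_finsetSum_measure fun i _ => hint _ _]
    refine Finset.sum_congr rfl fun i _ => ?_
    rw [integral_smul_nnreal_measure]
    rfl
  -- Moving the negative parts of the coefficients to the left leaves finite positive measures on
  -- both sides, which characteristic functions determine.
  have heq : μ + ∑ i ∈ J, (-c i).toNNReal • ν i = ∑ i ∈ J, (c i).toNNReal • ν i := by
    refine Measure.ext_of_charFun (funext fun t => ?_)
    rw [charFun_apply_real, integral_add_measure (hint _ _) (hint _ _), ← charFun_apply_real,
      ← charFun_apply_real, hsum, hsum, h, ← Finset.sum_add_distrib]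
    refine Finset.sum_congr rfl fun i _ => ?_
    rw [← add_mul, ← Complex.ofReal_add]
    congr 2
    linarith [hsplit i]
  have hreal : ∀ d : ι → NNReal,
      (∑ i ∈ J, d i • ν i).real s = ∑ i ∈ J, (d i : ℝ) * (ν i).real s := by
    intro d
    rw [measureReal_def, Measure.finsetSum_apply, ENNReal.toReal_sum fun i _ => measure_ne_top _ _]
    refine Finset.sum_congr rfl fun i _ => ?_
    rw [← measureReal_def, measureReal_nnreal_smul_apply]
  have h2 := congrArg (fun ρ : Measure ℝ => ρ.real s) heq
  beta_reduce at h2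
  rw [measureReal_add_apply, hreal, hreal] at h2
  rw [eq_sub_of_add_eq h2, ← Finset.sum_sub_distrib]
  refine Finset.sum_congr rfl fun i _ => ?_
  rw [← sub_mul, hsplit]

end GammaDistribution

end MISO

namespace MISO

/-! ### Monotonicity, range and inversion of the logistic circuit. -/

section HarvestedPower

lemma harvestedPower_zero (Ps A B : ℝ) : harvestedPower Ps A B 0 = 0 := by
  have := Real.exp_pos (A * B)
  have h : -A * (0 - B) = A * B := by ring
  rw [harvestedPower, h]
  field_simp
  ring

lemma harvestedPower_mono {Ps A : ℝ} (hPs : 0 < Ps) (hA : 0 < A) (B : ℝ) :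
    Monotone (harvestedPower Ps A B) := by
  intro x y hxy
  have := Real.exp_pos (A * B)
  have : Real.exp (-A * (y - B)) ≤ Real.exp (-A * (x - B)) := Real.exp_le_exp.2 (by nlinarith)
  unfold harvestedPower
  gcongr

lemma harvestedPower_lt {Ps : ℝ} (hPs : 0 < Ps) (A B x : ℝ) : harvestedPower Ps A B x < Ps := by
  have hE := Real.exp_pos (A * B)
  have hy := Real.exp_pos (-A * (x - B))
  have : Ps * (1 + Real.exp (A * B)) / (Real.exp (A * B) * (1 + Real.exp (-A * (x - B)))) <
      Ps * (1 + Real.exp (A * B)) / Real.exp (A * B) := by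
    refine div_lt_div_of_pos_left (by positivity) hE ?_
    nlinarith [mul_pos hE hy]
  have h2 : Ps * (1 + Real.exp (A * B)) / Real.exp (A * B) = Ps / Real.exp (A * B) + Ps := by
    field_simp
  rw [harvestedPower]
  linarith

/-- Solving for the exponential and taking logarithms: `0 ≤ q` keeps the denominator positive, and
`q < Ps` makes the argument of the logarithm positive. -/
lemma harvestedPower_le_iff {Ps A : ℝ} (hPs : 0 < Ps) (hA : 0 < A) (B : ℝ) {q : ℝ}
    (hq : q ∈ Set.Ico 0 Ps) (x : ℝ) :
    harvestedPower Ps A B x ≤ q ↔ x ≤ -(logTerm Ps A B q / A) := by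
  obtain ⟨hq0, hq1⟩ := hq
  rw [harvestedPower, logTerm, sub_le_iff_le_add]
  have hE := Real.exp_pos (A * B)
  have hy := Real.exp_pos (-A * (x - B))
  have hd : 0 < q + Ps / Real.exp (A * B) := by positivity
  have hR : 0 < Ps * (1 + Real.exp (A * B)) /
      (Real.exp (A * B) * (q + Ps / Real.exp (A * B))) - 1 := by
    rw [sub_pos, one_lt_div (by positivity)]
    have : Real.exp (A * B) * (q + Ps / Real.exp (A * B)) = Real.exp (A * B) * q + Ps := by
      field_simp
    rw [this]
    nlinarith
  have h1 : Ps * (1 + Real.exp (A * B)) / (Real.exp (A * B) * (1 + Real.exp (-A * (x - B)))) ≤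
      q + Ps / Real.exp (A * B) ↔ Ps * (1 + Real.exp (A * B)) /
      (Real.exp (A * B) * (q + Ps / Real.exp (A * B))) - 1 ≤ Real.exp (-A * (x - B)) := by
    rw [sub_le_iff_le_add, div_le_iff₀ (by positivity), div_le_iff₀ (by positivity)]
    refine iff_of_eq (congrArg _ ?_)
    ring
  rw [h1, ← Real.log_le_iff_le_exp hR, ← neg_div, le_div_iff₀ hA]
  constructor <;> intro h <;> linarith

end HarvestedPower

/-! ### Sums of independent gamma variables. -/

section Sums

variable {Ω : Type*} [MeasurableSpace Ω] {μ : Measure Ω}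

lemma charFun_map_sum_gamma {ι : Type*} [Fintype ι] {X : ι → Ω → ℝ} {a : ι → ℕ} {β : ι → ℝ}
    (ha : ∀ i, 0 < a i) (hβ : ∀ i, 0 < β i)
    (hX : ∀ i, HasLaw (X i) (gammaMeasure (a i) (β i)) μ) (hindep : iIndepFun X μ) (t : ℝ) :
    charFun (μ.map fun ω => ∑ i, X i ω) t =
      ∏ i, ((β i : ℂ) / (β i + -(t * Complex.I))) ^ a i := by
  rw [hindep.charFun_map_fun_sum_eq_prod fun i => (hX i).aemeasurable, Finset.prod_apply]
  refine Finset.prod_congr rfl fun i _ => ?_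
  rw [(hX i).map_eq, charFun_gammaMeasure (ha i) (hβ i)]

variable [IsProbabilityMeasure μ]

/-- A sum of independent gamma variables with integer shapes and a common rate. -/
lemma hasLaw_sum_gamma {ι : Type*} [Fintype ι] [Nonempty ι] {X : ι → Ω → ℝ} {a : ι → ℕ} {r : ℝ}
    (ha : ∀ i, 0 < a i) (hr : 0 < r)
    (hX : ∀ i, HasLaw (X i) (gammaMeasure (a i) r) μ) (hindep : iIndepFun X μ) :
    HasLaw (fun ω => ∑ i, X i ω) (gammaMeasure (∑ i, (a i : ℝ)) r) μ := by
  have hmeas : AEMeasurable (fun ω => ∑ i, X i ω) μ :=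
    Finset.aemeasurable_fun_sum _ fun i _ => (hX i).aemeasurable
  have hpos : 0 < ∑ i, a i := Finset.sum_pos (fun i _ => ha i) Finset.univ_nonempty
  have := Measure.isProbabilityMeasure_map hmeas
  have := isProbabilityMeasure_gammaMeasure (Nat.cast_pos (α := ℝ).2 hpos) hr
  refine ⟨hmeas, ?_⟩
  rw [← Nat.cast_sum]
  refine Measure.ext_of_charFun (funext fun t => ?_)
  rw [charFun_map_sum_gamma ha (fun _ => hr) hX hindep, charFun_gammaMeasure hpos hr,
    Finset.prod_pow_eq_pow_sum]

/-- The law of a sum of independent gamma variables with integer shapes and pairwise distinct rates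
is a signed mixture of gamma distributions. -/
lemma measureReal_map_sum_gamma {n : ℕ} {X : Fin (n + 1) → Ω → ℝ} {a : Fin (n + 1) → ℕ}
    {β : Fin (n + 1) → ℝ} (ha : ∀ i, 0 < a i) (hβ : ∀ i, 0 < β i) (hinj : Function.Injective β)
    (hX : ∀ i, HasLaw (X i) (gammaMeasure (a i) (β i)) μ) (hindep : iIndepFun X μ) (s : Set ℝ) :
    (μ.map fun ω => ∑ i, X i ω).real s =
      ∑ i, ∑ k ∈ Finset.Icc 1 (a i), Xi i k a β * (gammaMeasure k (β i)).real s := by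
  have hmeas : AEMeasurable (fun ω => ∑ i, X i ω) μ :=
    Finset.aemeasurable_fun_sum _ fun i _ => (hX i).aemeasurable
  have := Measure.isProbabilityMeasure_map hmeas
  -- The mixture lemma asks for finiteness at every index, also at shape `0`, which the sum never
  -- reaches; the zero measure is put there.
  have hfin : ∀ x : (_ : Fin (n + 1)) × ℕ,
      IsFiniteMeasure (if 0 < x.2 then gammaMeasure x.2 (β x.1) else 0) := by
    intro x
    split_ifs with hx
    · have := isProbabilityMeasure_gammaMeasure (Nat.cast_pos (α := ℝ).2 hx) (hβ x.1)
      infer_instance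
    · infer_instance
  have hgamma : ∀ i, ∀ k ∈ Finset.Icc 1 (a i),
      (if 0 < k then gammaMeasure k (β i) else 0) = gammaMeasure k (β i) :=
    fun i k hk => if_pos (Finset.mem_Icc.1 hk).1
  have key := measureReal_eq_sum_of_charFun_eq_sum
    (Finset.univ.sigma fun i => Finset.Icc 1 (a i)) (μ.map fun ω => ∑ i, X i ω)
    (fun x => if 0 < x.2 then gammaMeasure x.2 (β x.1) else 0) (fun x => Xi x.1 x.2 a β) ?_ s
  · rw [key, Finset.sum_sigma]
    refine Finset.sum_congr rfl fun i _ => Finset.sum_congr rfl fun k hk => ?_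
    rw [hgamma i k hk]
  · intro t
    rw [charFun_map_sum_gamma ha hβ hX hindep, prod_div_pow_eq_sum_Xi a ha β hinj
      (fun i => (hβ i).ne') _ (fun i h => ?_), Finset.sum_sigma]
    · refine Finset.sum_congr rfl fun i _ => Finset.sum_congr rfl fun k hk => ?_
      dsimp only
      rw [hgamma i k hk, charFun_gammaMeasure (Finset.mem_Icc.1 hk).1 (hβ i)]
    · have := congrArg Complex.re h
      simp at this
      exact (hβ i).ne' this

end Sums

end MISO

/-! ### The CDF of the harvested power. -/

theorem mainTheorem5 {Ω : Type*} [MeasurableSpace Ω] (μ : Measure Ω) [IsProbabilityMeasure μ]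
    (n : ℕ) (a : Fin (n + 1) → ℕ) (b l p : Fin (n + 1) → ℝ) (Ps A B : ℝ)
    (ha : ∀ i, 0 < a i) (hb : ∀ i, 0 < b i) (hl : ∀ i, 0 < l i) (hp : ∀ i, 0 < p i)
    (hPs : 0 < Ps) (hA : 0 < A) (hB : 0 < B)
    (h : Fin (n + 1) → Ω → ℂ)
    (hlaw : ∀ i, HasLaw (fun ω => ‖h i ω‖) (MISO.nakagamiMeasure (a i) (a i / b i)) μ)
    (hindep : iIndepFun (fun i ω => ‖h i ω‖) μ)
    (Q : Ω → ℝ)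
    (hQ : ∀ ω, Q ω = MISO.harvestedPower Ps A B (MISO.receivedPower l p fun i => h i ω)) :
    -- the received power is a sum of independent gamma random variables
    (∀ i, HasLaw (fun ω => l i * p i * ‖h i ω‖ ^ 2)
      (gammaMeasure (a i) (b i / (l i * p i))) μ) ∧
    iIndepFun (fun i ω => l i * p i * ‖h i ω‖ ^ 2) μ ∧
    -- the harvested power is a random variable, and its distribution function outside `[0, Ps)`
    AEMeasurable Q μ ∧
    (∀ q < 0, cdf (μ.map Q) q = 0) ∧
    (∀ q, Ps ≤ q → cdf (μ.map Q) q = 1) ∧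
    -- all `b i / (l i * p i)` equal
    ((∀ i j, b i / (l i * p i) = b j / (l j * p j)) →
      ∀ i, ∀ q ∈ Set.Ico 0 Ps,
        cdf (μ.map Q) q = 1 / Real.Gamma (∑ w, (a w : ℝ)) *
          MISO.lowerGamma (∑ w, (a w : ℝ))
            (-(b i / (A * l i * p i)) * MISO.logTerm Ps A B q)) ∧
    -- the `b i / (l i * p i)` pairwise distinct
    ((∀ i j, i ≠ j → b i / (l i * p i) ≠ b j / (l j * p j)) →
      ∀ q ∈ Set.Ico 0 Ps,
        cdf (μ.map Q) q = ∑ i, ∑ k ∈ Finset.Icc 1 (a i),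
          1 / Real.Gamma (k : ℝ) *
            MISO.lowerGamma (k : ℝ)
              (-(b i / (A * l i * p i)) * MISO.logTerm Ps A B q) *
            MISO.Xi i k a (fun w => b w / (l w * p w))) := by
  set X : Fin (n + 1) → Ω → ℝ := fun i ω => l i * p i * ‖h i ω‖ ^ 2 with hXdef
  set β : Fin (n + 1) → ℝ := fun w => b w / (l w * p w) with hβdef
  have hc : ∀ i, 0 < l i * p i := fun i => mul_pos (hl i) (hp i)
  have hβ : ∀ i, 0 < β i := fun i => div_pos (hb i) (hc i)
  have ha' : ∀ i, (0 : ℝ) < a i := fun i => Nat.cast_pos.2 (ha i)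
  have hX : ∀ i, HasLaw (X i) (gammaMeasure (a i) (β i)) μ := fun i =>
    (MISO.hasLaw_mul_sq_nakagamiMeasure (ha' i) (hb i) (hc i)).fun_comp (hlaw i)
  have hXindep : iIndepFun X μ :=
    hindep.comp (fun i x => l i * p i * x ^ 2) fun i => by fun_prop
  have hS : AEMeasurable (fun ω => ∑ i, X i ω) μ :=
    Finset.aemeasurable_fun_sum _ fun i _ => (hX i).aemeasurable
  have hQS : Q = MISO.harvestedPower Ps A B ∘ fun ω => ∑ i, X i ω := funext hQ
  have hmono := MISO.harvestedPower_mono hPs hA B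
  have hQm : AEMeasurable Q μ := hQS ▸ hmono.measurable.comp_aemeasurable hS
  have := Measure.isProbabilityMeasure_map hQm
  have hQ0 : ∀ ω, 0 ≤ Q ω := fun ω => by
    rw [hQ, ← MISO.harvestedPower_zero Ps A B]
    exact hmono (Finset.sum_nonneg fun i _ => mul_nonneg (hc i).le (by positivity))
  have hcdf : ∀ q, cdf (μ.map Q) q = μ.real {ω | Q ω ≤ q} := fun q => by
    rw [cdf_eq_real, map_measureReal_apply_of_aemeasurable hQm measurableSet_Iic]
    rfl
  -- The input `0` yields output `0 ≤ q`, so it lies below the threshold; the gamma CDF formula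
  -- needs this sign.
  have hthreshold : ∀ q ∈ Set.Ico 0 Ps, 0 ≤ -(MISO.logTerm Ps A B q / A) := fun q hq =>
    (MISO.harvestedPower_le_iff hPs hA B hq 0).1 ((MISO.harvestedPower_zero Ps A B).trans_le hq.1)
  have hcdfS : ∀ q ∈ Set.Ico 0 Ps, cdf (μ.map Q) q =
      (μ.map fun ω => ∑ i, X i ω).real (Set.Iic (-(MISO.logTerm Ps A B q / A))) := fun q hq => by
    rw [hcdf, map_measureReal_apply_of_aemeasurable hS measurableSet_Iic]
    congr 1
    ext ω
    rw [hQS]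
    exact MISO.harvestedPower_le_iff hPs hA B hq _
  have harg : ∀ i q, -(b i / (A * l i * p i)) * MISO.logTerm Ps A B q =
      β i * -(MISO.logTerm Ps A B q / A) := fun i q => by
    have := (hl i).ne'
    have := (hp i).ne'
    simp only [hβdef]
    field_simp
  refine ⟨hX, hXindep, hQm, fun q hq => ?_, fun q hq => ?_, fun heq i q hq => ?_,
    fun hne q hq => ?_⟩
  · have hempty : {ω | Q ω ≤ q} = ∅ :=
      Set.eq_empty_of_forall_notMem fun ω hω => (hq.trans_le (hQ0 ω)).not_ge hω
    rw [hcdf, hempty, measureReal_empty]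
  · have huniv : {ω | Q ω ≤ q} = Set.univ := Set.eq_univ_of_forall fun ω =>
      (hQ ω).trans_le ((MISO.harvestedPower_lt hPs A B _).le.trans hq)
    rw [hcdf, huniv, probReal_univ]
  · have hX' : ∀ j, HasLaw (X j) (gammaMeasure (a j) (β i)) μ := fun j =>
      (show β j = β i from heq j i) ▸ hX j
    rw [hcdfS q hq, (MISO.hasLaw_sum_gamma ha (hβ i) hX' hXindep).map_eq,
      MISO.measureReal_gammaMeasure_Iic (Finset.sum_pos (fun j _ => ha' j) Finset.univ_nonempty)
        (hβ i) (hthreshold q hq), harg]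
  · have hinj : Function.Injective β := fun i j hij => by_contra fun h => hne i j h hij
    rw [hcdfS q hq, MISO.measureReal_map_sum_gamma ha hβ hinj hX hXindep]
    refine Finset.sum_congr rfl fun i _ => Finset.sum_congr rfl fun k hk => ?_
    rw [MISO.measureReal_gammaMeasure_Iic (Nat.cast_pos.2 (Finset.mem_Icc.1 hk).1) (hβ i)
      (hthreshold q hq), harg, mul_comm]
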